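/- Let $f(w)=\sum_{n=0}^{\infty}a_nw^n$ be a non-constant entire function of order $\rho$, where $0\le\rho<1$. (The order is the infimum of all $\alpha\ge 0$ such that $|f(w)|\le e^{|w|^{\alpha}}$ for all $w$ of sufficiently large modulus.) The automorphic functions of $f$ are the, in general multivalued, analytic solutions $\phi$ of $f\circ\phi=f$, that is, the branches of $f^{-1}\circ f$. Let $z\in\mathbb{C}$ with $f(z)\neq f(0)$, fix any direction at $z$, and let $\{\phi_{0i}\}_{i\ge 0}$ be the (finite or infinite) list, without repetition, of the leaves at $z$ of the automorphic functions of $f$: the germs at $z$ of single-valued holomorphic solutions $\phi$ of $f\circ\phi=f$ on small discs about $z$ that are cut along the ray from $z$ in the fixed direction, such that $\phi(\zeta)$ has a finite limit, denoted $\phi(z)$, as $\zeta\to z$. (Different leaves may take the same value at $z$; each of them is counted.) Then for every integer $n\ge 1$ $$a_n=(-1)^n\,\bigl(f(0)-f(z)\bigr)\sum_{0\le i_1<i_2<\dots<i_n}\ \Bigl(\prod_{j=1}^{n}\phi_{0i_j}(z)\Bigr)^{-1},$$ where the sum, over all $n$-element sets of leaves, converges absolutely (it is $0$ if there are fewer than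 $n$ leaves). -/

import Mathlib

open Filter Topology
open scoped ENNReal NNReal

noncomputable section

/-- The order (of growth) of an entire function: the infimum of the exponents `α ≥ 0` such that
`|f w| ≤ exp (|w| ^ α)` for all `w` of sufficiently large modulus (`∞` if there are none). -/
def entireOrder (f : ℂ → ℂ) : ℝ≥0∞ :=
  ⨅ (α : ℝ≥0) (_ : ∀ᶠ w in cocompact ℂ, ‖f w‖ ≤ Real.exp (‖w‖ ^ (α : ℝ))), (α : ℝ≥0∞)

/-- The filter of slit punctured neighbourhoods of `z`: it is generated by the small discs about
`z`, cut along the closed ray that starts at `z` in the direction `-u` (for `u ≠ 0`). -/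
def slitNhds (z u : ℂ) : Filter ℂ :=
  𝓝[{ζ : ℂ | (ζ - z) / u ∈ Complex.slitPlane}] z

/-- `IsAutomorphicBranch f z u φ w`: on some disc about `z`, cut along the ray in direction `-u`,
the function `φ` is holomorphic and solves the automorphic equation `f ∘ φ = f`, and its value
at `z` (its limit there) is `w`. -/
structure IsAutomorphicBranch (f : ℂ → ℂ) (z u : ℂ) (φ : ℂ → ℂ) (w : ℂ) : Prop where
  differentiableAt : ∀ᶠ ζ in slitNhds z u, DifferentiableAt ℂ φ ζ
  automorphic : ∀ᶠ ζ in slitNhds z u, f (φ ζ) = f ζ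
  tendsto : Tendsto φ (slitNhds z u) (𝓝 w)

/-- The leaves at `z` of the (in general multivalued) automorphic functions of `f`, i.e. of
`f⁻¹ ∘ f`: germs of single-valued holomorphic solutions `φ` of `f ∘ φ = f` on slit discs about `z`,
together with their finite value at `z`. Distinct leaves may take the same value at `z`; this
happens at the critical points of `f` in the fibre of `z`. -/
@[ext]
structure AutomorphicBranch (f : ℂ → ℂ) (z u : ℂ) where
  /-- the germ of the automorphic function -/
  germ : (slitNhds z u).Germ ℂ
  /-- the point `φ(z)` of the orbit of `z` -/
  value : ℂ
  isBranch : ∃ φ : ℂ → ℂ, (φ : (slitNhds z u).Germ ℂ) = germ ∧ IsAutomorphicBranch f z u φ value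

end

/-! Normalise to `g w = (f w - f z) / (f 0 - f z)`, which is entire of order less than one with `g 0
= 1`. Hadamard's theorem then has no exponential factor: `g` is the absolutely convergent product of
`1 - w / v` over its zeros `v` with multiplicity (`hasProd_one_sub_div`). Expanding this product
gives Taylor coefficients that are signed elementary symmetric functions of the `v⁻¹`
(`coeff_eq_of_hasProd_one_sub_div`).

It remains to see that the leaves enumerate the zeros with multiplicity
(`AutomorphicBranch.encard_value_eq`). Near a zero `w` of order `m`, `f - f z = ψ ^ m` for a local
coordinate `ψ`. On a slit disc about `z`, where `f - f z` has a holomorphic `m`-th root `θ`, the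
equation `f ∘ φ = f` becomes `ψ ∘ φ = ω θ` with `ω ^ m = 1`, so exactly `m` leaves have value `w`.
-/

/-! ### Hadamard products in order less than one. -/

section ZeroProducts

open Complex Metric

/-- A zero-free holomorphic function on a disc with value `1` at the centre has a holomorphic
logarithm that vanishes at the centre. -/
theorem exists_log_on_ball {H : ℂ → ℂ} {R : ℝ} (hR : 0 < R)
    (hH : DifferentiableOn ℂ H (ball 0 R)) (hne : ∀ w ∈ ball (0 : ℂ) R, H w ≠ 0) (h0 : H 0 = 1) :
    ∃ L : ℂ → ℂ, DifferentiableOn ℂ L (ball 0 R) ∧ L 0 = 0 ∧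
      ∀ w ∈ ball (0 : ℂ) R, exp (L w) = H w := by
  have hd : DifferentiableOn ℂ (fun w => deriv H w / H w) (ball 0 R) :=
    (hH.deriv isOpen_ball).div hH hne
  obtain ⟨L, hL0, hL⟩ := hd.isExactOn_ball.with_val_at 0 0
  refine ⟨L, fun w hw => (hL w hw).differentiableAt.differentiableWithinAt, hL0, fun w hw => ?_⟩
  have hder : ∀ x ∈ ball (0 : ℂ) R, HasDerivAt (fun x => H x * exp (-L x)) 0 x := by
    intro x hx
    have h1 : HasDerivAt H (deriv H x) x :=
      (hH.differentiableAt (isOpen_ball.mem_nhds hx)).hasDerivAt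
    have h2 := h1.mul (hL x hx).neg.cexp
    convert! h2 using 1
    field_simp [hne x hx]
    ring
  have hconst : H w * exp (-L w) = H 0 * exp (-L 0) :=
    (isOpen_ball.is_const_of_deriv_eq_zero (convex_ball _ _).isPreconnected
      (fun x hx => (hder x hx).differentiableAt.differentiableWithinAt)
      (fun x hx => (hder x hx).deriv) hw (mem_ball_self hR))
  rw [h0, hL0, neg_zero, exp_zero, mul_one, exp_neg, mul_inv_eq_one₀ (exp_ne_zero _)] at hconst
  exact hconst.symm

variable {I : Type*} {v : I → ℂ}

theorem analyticOrderAt_one_sub_div {c : ℂ} (hc : c ≠ 0) (w : ℂ) :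
    analyticOrderAt (fun x => 1 - x / c) w = if c = w then 1 else 0 := by
  have h1 : (fun x : ℂ => 1 - x / c) = (fun _ => -c⁻¹) * (fun x => x - c) := by
    ext x
    simp only [Pi.mul_apply]
    field_simp
    ring
  rw [h1, analyticOrderAt_mul (by fun_prop) (by fun_prop)]
  have h2 : analyticOrderAt (fun _ : ℂ => -c⁻¹) w = 0 := by
    rw [analyticOrderAt_eq_zero]
    right
    simpa using hc
  rw [h2, zero_add]
  split_ifs with h
  · subst h
    simp
  · simp [Ne.symm h]

theorem analyticOrderAt_prod_one_sub_div (hv : ∀ i, v i ≠ 0) (s : Finset I) (w : ℂ) :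
    analyticOrderAt (fun x => ∏ i ∈ s, (1 - x / v i)) w = {i | i ∈ s ∧ v i = w}.encard := by
  classical
  induction s using Finset.induction_on with
  | empty =>
    simp [analyticOrderAt_eq_zero]
  | insert i s hi ih =>
    have h1 : (fun x => ∏ j ∈ insert i s, (1 - x / v j)) =
        (fun x => 1 - x / v i) * fun x => ∏ j ∈ s, (1 - x / v j) := by
      ext x
      simp [Finset.prod_insert hi]
    rw [h1, analyticOrderAt_mul (by fun_prop)
      (Differentiable.analyticAt (by fun_prop) w), ih, analyticOrderAt_one_sub_div (hv i)]
    split_ifs with h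
    · have : {j | j ∈ insert i s ∧ v j = w} = insert i {j | j ∈ s ∧ v j = w} := by
        ext j
        simp only [Finset.mem_insert, Set.mem_ofPred_eq, Set.mem_insert_iff]
        constructor
        · rintro ⟨rfl | h1, h2⟩ <;> tauto
        · rintro (rfl | h1) <;> tauto
      rw [this, Set.encard_insert_of_notMem (by simp [hi]), add_comm]
    · rw [zero_add]
      congr 1
      ext j
      simp only [Finset.mem_insert, Set.mem_ofPred_eq]
      constructor
      · tauto
      · rintro ⟨rfl | h1, h2⟩ <;> tauto

/-- Finitely many of the zeros of an entire function can be divided out. -/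
theorem exists_eq_prod_mul {g : ℂ → ℂ} (hg : Differentiable ℂ g) (hv : ∀ i, v i ≠ 0)
    (hord : ∀ w, {i | v i = w}.encard = analyticOrderAt g w) (s : Finset I) :
    ∃ h : ℂ → ℂ, Differentiable ℂ h ∧ ∀ w, g w = (∏ i ∈ s, (1 - w / v i)) * h w := by
  classical
  induction s using Finset.induction_on with
  | empty => exact ⟨g, hg, by simp⟩
  | insert i s hi ih =>
    obtain ⟨h, hh, hgh⟩ := ih
    have hgh' : g = (fun x => ∏ j ∈ s, (1 - x / v j)) * h := funext hgh
    -- Otherwise the order of `g` at `v i` would count only indices in `s`, missing `i` itself.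
    have hzero : h (v i) = 0 := by
      by_contra hne
      have h1 := hord (v i)
      rw [hgh', analyticOrderAt_mul (Differentiable.analyticAt (by fun_prop) _)
        (hh.analyticAt _), analyticOrderAt_prod_one_sub_div hv,
        (hh.analyticAt _).analyticOrderAt_eq_zero.2 hne, add_zero] at h1
      have hfin : {j | j ∈ s ∧ v j = v i}.Finite := s.finite_toSet.subset fun j hj => hj.1
      have hlt : {j | j ∈ s ∧ v j = v i} ⊂ {j | v j = v i} :=
        ⟨fun j hj => hj.2, fun hsub => hi (hsub (show v i = v i from rfl)).1⟩
      exact (hfin.encard_lt_encard hlt).ne' h1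
    refine ⟨fun w => -v i * dslope h (v i) w, ?_, fun w => ?_⟩
    · have : Differentiable ℂ (dslope h (v i)) := by
        rw [← differentiableOn_univ, differentiableOn_dslope univ_mem, differentiableOn_univ]
        exact hh
      fun_prop
    · have h1 := sub_smul_dslope h (v i) w
      rw [hzero, sub_zero, smul_eq_mul] at h1
      rw [hgh w, ← h1, Finset.prod_insert hi]
      field_simp [hv i]
      ring

/-- Dividing out zeros in a disc makes an entire function small on the disc of triple radius. -/
theorem norm_mul_two_pow_card_le {g h : ℂ → ℂ} (hh : Differentiable ℂ h) (hv : ∀ i, v i ≠ 0)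
    {s : Finset I} (hgh : ∀ w, g w = (∏ i ∈ s, (1 - w / v i)) * h w) {R B : ℝ} (hR : 0 < R)
    (hs : ∀ i ∈ s, ‖v i‖ ≤ R) (hB : ∀ w, ‖w‖ = 3 * R → ‖g w‖ ≤ B) {w : ℂ} (hw : ‖w‖ ≤ 3 * R) :
    ‖h w‖ * 2 ^ s.card ≤ B := by
  rw [← le_div_iff₀ (by positivity)]
  -- Maximum principle: on the circle of radius `3 * R` each factor `1 - x / v i` has modulus at
  -- least `3 - 1 = 2`.
  refine norm_le_of_forall_mem_frontier_norm_le (U := ball 0 (3 * R)) isBounded_ball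
    hh.diffContOnCl (fun x hx => ?_) (by rw [closure_ball _ (by positivity)]; simpa using hw)
  rw [frontier_ball _ (by positivity), mem_sphere_zero_iff_norm] at hx
  rw [le_div_iff₀ (by positivity), mul_comm]
  refine le_trans ?_ (hB x hx)
  rw [hgh x, norm_mul, norm_prod, ← Finset.prod_const]
  gcongr with i hi
  have h1 : 3 ≤ ‖x / v i‖ := by
    rw [norm_div, hx, le_div_iff₀ (norm_pos_iff.2 (hv i))]
    linarith [hs i hi]
  have h2 := norm_sub_norm_le (x / v i) 1
  rw [norm_sub_rev] at h2
  simp only [norm_one] at h2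
  linarith

/-- A sequence with counting function `O(R ^ α)`, `α < 1`, has summable inverses. -/
theorem summable_inv_norm_of_card_le {α K : ℝ} (hα : α < 1)
    (hK : ∀ R : ℝ, 1 ≤ R → ∀ s : Finset I, (∀ i ∈ s, ‖v i‖ ≤ R) → (s.card : ℝ) ≤ K * R ^ α) :
    Summable fun i => ‖v i‖⁻¹ := by
  classical
  have hfin : {i | ‖v i‖ < 1}.Finite := by
    by_contra hinf
    obtain ⟨t, ht, hcard⟩ := Set.Infinite.exists_subset_card_eq hinf (⌊K⌋₊ + 1)
    have h1 := hK 1 le_rfl t fun i hi => (ht hi).le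
    rw [Real.one_rpow, mul_one, hcard] at h1
    have := Nat.lt_floor_add_one K
    push_cast at h1
    linarith
  rw [← hfin.summable_compl_iff]
  have hgeom : Summable fun j : ℕ => K * (2 : ℝ) ^ α * ((2 : ℝ) ^ (α - 1)) ^ j := by
    refine (summable_geometric_of_lt_one (by positivity) ?_).mul_left _
    exact Real.rpow_lt_one_of_one_lt_of_neg one_lt_two (by linarith)
  refine summable_of_sum_le (c := ∑' j : ℕ, K * (2 : ℝ) ^ α * ((2 : ℝ) ^ (α - 1)) ^ j)
    (fun i => inv_nonneg.2 (norm_nonneg _)) fun s => ?_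
  -- Dyadic shells: the shell `2 ^ j ≤ ‖v i‖ < 2 ^ (j + 1)` contributes at most `K * (2 ^ (j + 1)) ^
  -- α / 2 ^ j`, a geometric term of ratio `2 ^ (α - 1) < 1`.
  have hterm : ∀ i : ({i | ‖v i‖ < 1}ᶜ : Set I), ∃ j : ℕ,
      (2 : ℝ) ^ j ≤ ‖v i‖ ∧ ‖v i‖ < 2 ^ (j + 1) := by
    intro i
    have : 1 ≤ ‖v i‖ := not_lt.1 i.2
    exact exists_nat_pow_near this one_lt_two
  choose J hJ1 hJ2 using hterm
  obtain ⟨N, hN⟩ : ∃ N, ∀ i ∈ s, J i ∈ Finset.range N := by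
    refine ⟨s.sup J + 1, fun i hi => ?_⟩
    rw [Finset.mem_range, Nat.lt_succ_iff]
    exact Finset.le_sup hi
  calc ∑ i ∈ s, ‖v i‖⁻¹ = ∑ j ∈ Finset.range N, ∑ i ∈ s with J i = j, ‖v i‖⁻¹ :=
        (Finset.sum_fiberwise_of_maps_to hN _).symm
    _ ≤ ∑ j ∈ Finset.range N, K * (2 : ℝ) ^ α * ((2 : ℝ) ^ (α - 1)) ^ j := by
        refine Finset.sum_le_sum fun j _ => ?_
        have hc := hK (2 ^ (j + 1)) (one_le_pow₀ one_le_two)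
          ((s.filter (J · = j)).map (Function.Embedding.subtype _)) (by
            intro i hi
            obtain ⟨i, hi', rfl⟩ := Finset.mem_map.1 hi
            exact (Finset.mem_filter.1 hi').2 ▸ (hJ2 i).le)
        rw [Finset.card_map] at hc
        calc ∑ i ∈ s with J i = j, ‖v i‖⁻¹ ≤ ∑ i ∈ s with J i = j, ((2 : ℝ) ^ j)⁻¹ := by
              refine Finset.sum_le_sum fun i hi => ?_
              gcongr
              exact (Finset.mem_filter.1 hi).2 ▸ hJ1 i
          _ = (s.filter (J · = j)).card * ((2 : ℝ) ^ j)⁻¹ := by simp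
          _ ≤ K * (2 ^ (j + 1)) ^ α * ((2 : ℝ) ^ j)⁻¹ := by gcongr
          _ = K * (2 : ℝ) ^ α * ((2 : ℝ) ^ (α - 1)) ^ j := by
              rw [Real.rpow_sub_one two_ne_zero, div_pow, pow_succ,
                Real.mul_rpow (by positivity) (by positivity), ← Real.rpow_natCast 2 j,
                ← Real.rpow_mul (by positivity), mul_comm (j : ℝ) α, Real.rpow_mul (by positivity),
                Real.rpow_natCast]
              ring
    _ ≤ _ := hgeom.sum_le_tsum _ (fun j _ => by
        have := hK 1 le_rfl ∅ (by simp)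
        simp at this
        positivity)

/-- A weak form of Jensen's bound: evaluating at the centre, where the quotient by the chosen
factors equals `1`, gives `2 ^ s.card ≤ C * exp ((3 * R) ^ α)`. After taking logarithms, `R ^ α ≥ 1`
absorbs `log C`. -/
theorem card_le_of_growth {g : ℂ → ℂ} (hg : Differentiable ℂ g) (hg0 : g 0 = 1)
    (hv : ∀ i, v i ≠ 0) (hord : ∀ w, {i | v i = w}.encard = analyticOrderAt g w) {C α : ℝ}
    (hC : 1 ≤ C) (hα : 0 ≤ α)
    (hgrowth : ∀ w, ‖g w‖ ≤ C * Real.exp (‖w‖ ^ α)) {R : ℝ} (hR : 1 ≤ R) {s : Finset I}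
    (hs : ∀ i ∈ s, ‖v i‖ ≤ R) :
    (s.card : ℝ) ≤ (Real.log C + 3 ^ α) / Real.log 2 * R ^ α := by
  obtain ⟨h, hh, hgh⟩ := exists_eq_prod_mul hg hv hord s
  have h0 : h 0 = 1 := by simpa [hg0] using (hgh 0).symm
  have key := norm_mul_two_pow_card_le hh hv hgh (by linarith) hs
    (B := C * Real.exp ((3 * R) ^ α)) (fun w hw => by simpa [hw] using hgrowth w)
    (w := 0) (by simp; linarith)
  rw [h0, norm_one, one_mul] at key
  have hlog := Real.log_le_log (by positivity) key
  rw [Real.log_pow, Real.log_mul (by positivity) (Real.exp_ne_zero _), Real.log_exp,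
    Real.mul_rpow (by norm_num) (by linarith)] at hlog
  rw [div_mul_eq_mul_div, le_div_iff₀ (Real.log_pos one_lt_two)]
  have h1 : 1 ≤ R ^ α := Real.one_le_rpow hR hα
  have h2 : 0 ≤ Real.log C := Real.log_nonneg hC
  nlinarith

/-- **Hadamard factorization** for entire functions of order less than one. -/
theorem hasProd_one_sub_div {g : ℂ → ℂ} (hg : Differentiable ℂ g) (hg0 : g 0 = 1)
    (hv : ∀ i, v i ≠ 0) (hord : ∀ w, {i | v i = w}.encard = analyticOrderAt g w) {C α : ℝ}
    (hC : 1 ≤ C) (hα : 0 ≤ α) (hα1 : α < 1)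
    (hgrowth : ∀ w, ‖g w‖ ≤ C * Real.exp (‖w‖ ^ α)) :
    (Summable fun i => ‖v i‖⁻¹) ∧ ∀ w, HasProd (fun i => 1 - w / v i) (g w) := by
  classical
  have hcard := fun R (hR : (1 : ℝ) ≤ R) (s : Finset I) (hs : ∀ i ∈ s, ‖v i‖ ≤ R) =>
    card_le_of_growth hg hg0 hv hord hC hα hgrowth hR hs
  have hsum : Summable fun i => ‖v i‖⁻¹ := summable_inv_norm_of_card_le hα1 hcard
  refine ⟨hsum, fun w => ?_⟩
  have hfin : ∀ R : ℝ, {i | ‖v i‖ ≤ R}.Finite := by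
    intro R
    have h1 := hsum.tendsto_cofinite_zero.eventually
      (gt_mem_nhds (show (0 : ℝ) < (max R 1)⁻¹ by positivity))
    refine h1.subset fun i hi => ?_
    have : ‖v i‖ ≤ max R 1 := le_max_of_le_left hi
    simpa using inv_anti₀ (norm_pos_iff.2 (hv i)) this
  set S : ℝ → Finset I := fun R => (hfin R).toFinset with hS
  have hStop : Tendsto S atTop atTop := by
    refine tendsto_atTop.2 fun T => ?_
    have : ∀ᶠ R : ℝ in atTop, ∀ i ∈ T, ‖v i‖ ≤ R :=
      (Filter.eventually_all_finset T).2 fun i _ => eventually_ge_atTop _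
    filter_upwards [this] with R hR i hi
    simpa [hS] using hR i hi
  have hmult : Multipliable fun i => 1 - w / v i := by
    have h1 : Summable fun i => ‖-(w / v i)‖ := by
      simpa [div_eq_mul_inv] using hsum.mul_left ‖w‖
    simpa [sub_eq_add_neg] using
      multipliable_one_add_of_summable_prod (summable_finsetProd_of_summable_norm h1)
  -- Dividing out all zeros of modulus at most `R` leaves `h = exp L` on the disc of radius `R`,
  -- with `Re L ≤ log C + (3 * R) ^ α`. Borel–Carathéodory turns this one-sided bound into a bound
  -- on `‖L w‖`.
  have hP : ∀ R : ℝ, 1 ≤ R → ‖w‖ < R → ∃ l : ℂ,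
      ‖l‖ ≤ 2 * (Real.log C + 1 + (3 * R) ^ α) * ‖w‖ / (R - ‖w‖) ∧
      g w * exp (-l) = ∏ i ∈ S R, (1 - w / v i) := by
    intro R hR hwR
    have hR0 : 0 < R := by linarith
    have hsS : ∀ i ∈ S R, ‖v i‖ ≤ R := fun i hi => by simpa [hS] using hi
    obtain ⟨h, hh, hgh⟩ := exists_eq_prod_mul hg hv hord (S R)
    have h0 : h 0 = 1 := by simpa [hg0] using (hgh 0).symm
    have hne : ∀ x ∈ ball (0 : ℂ) R, h x ≠ 0 := by
      intro x hx hx0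
      have hgh' : g = (fun x => ∏ j ∈ S R, (1 - x / v j)) * h := funext hgh
      have h1 := hord x
      have h2 : {i | i ∈ S R ∧ v i = x} = {i | v i = x} := by
        ext i
        simp only [Set.mem_ofPred_eq, and_iff_right_iff_imp]
        rintro rfl
        simpa [hS] using (mem_ball_zero_iff.1 hx).le
      have h4 : analyticOrderAt h x ≠ 0 := (hh.analyticAt x).analyticOrderAt_ne_zero.2 hx0
      have h3 : {i | v i = x}.Finite := h2 ▸ (S R).finite_toSet.subset fun i hi => hi.1
      rw [hgh', analyticOrderAt_mul (Differentiable.analyticAt (by fun_prop) _)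
        (hh.analyticAt _), analyticOrderAt_prod_one_sub_div hv, h2] at h1
      -- Cancellation in `ℕ∞` is legitimate because the index set over `x` is finite.
      nth_rewrite 1 [← add_zero ({i | v i = x}.encard)] at h1
      exact h4 (WithTop.add_left_cancel h3.encard_lt_top.ne h1).symm
    obtain ⟨L, hL, hL0, hexp⟩ := exists_log_on_ball hR0 hh.differentiableOn hne h0
    refine ⟨L w, ?_, ?_⟩
    · have hlogC := Real.log_nonneg hC
      refine borelCaratheodory_zero (by positivity) hL (fun x hx => ?_) hR0
        (mem_ball_zero_iff.2 hwR) hL0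
      have hx' := mem_ball_zero_iff.1 hx
      have h1 := norm_mul_two_pow_card_le hh hv hgh hR0 hsS
        (B := C * Real.exp ((3 * R) ^ α)) (fun w hw => by simpa [hw] using hgrowth w)
        (w := x) (by linarith)
      have h2 : ‖h x‖ ≤ C * Real.exp ((3 * R) ^ α) :=
        le_trans (le_mul_of_one_le_right (norm_nonneg _) (one_le_pow₀ one_le_two)) h1
      rw [← hexp x hx, norm_exp] at h2
      have h3 := Real.log_le_log (Real.exp_pos _) h2
      rw [Real.log_exp, Real.log_mul (by positivity) (Real.exp_ne_zero _), Real.log_exp] at h3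
      show (L x).re ≤ _
      linarith
    · have hw' := mem_ball_zero_iff.2 hwR
      rw [hgh w, ← hexp w hw', mul_assoc, ← exp_add]
      simp
  -- Here `α < 1` rules out an exponential factor: the bound is `O(R ^ (α - 1))`.
  have hlim : Tendsto (fun R : ℝ => 2 * (Real.log C + 1 + (3 * R) ^ α) * ‖w‖ / (R - ‖w‖))
      atTop (𝓝 0) := by
    have e1 : Tendsto (fun R : ℝ => R⁻¹) atTop (𝓝 0) := tendsto_inv_atTop_zero
    have e2 : Tendsto (fun R : ℝ => R ^ (α - 1)) atTop (𝓝 0) := by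
      simpa using tendsto_rpow_neg_atTop (y := 1 - α) (by linarith)
    have e3 : Tendsto (fun R : ℝ => 2 * ((Real.log C + 1) * R⁻¹ + 3 ^ α * R ^ (α - 1)) * ‖w‖ /
        (1 - ‖w‖ * R⁻¹)) atTop (𝓝 (2 * ((Real.log C + 1) * 0 + 3 ^ α * 0) * ‖w‖ /
        (1 - ‖w‖ * 0))) :=
      ((((e1.const_mul _).add (e2.const_mul _)).const_mul _).mul_const _).div
        (tendsto_const_nhds.sub (e1.const_mul _)) (by simp)
    simp only [mul_zero, add_zero, zero_mul, zero_div] at e3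
    refine e3.congr' ?_
    filter_upwards [eventually_gt_atTop 0, eventually_gt_atTop ‖w‖] with R hR hRw
    have : R - ‖w‖ ≠ 0 := by linarith
    rw [Real.rpow_sub_one hR.ne', Real.mul_rpow (by norm_num) hR.le]
    field_simp
  have hl : ∀ R : ℝ, ∃ l : ℂ, 1 ≤ R → ‖w‖ < R →
      (‖l‖ ≤ 2 * (Real.log C + 1 + (3 * R) ^ α) * ‖w‖ / (R - ‖w‖) ∧
      g w * exp (-l) = ∏ i ∈ S R, (1 - w / v i)) := by
    intro R
    by_cases hR : 1 ≤ R ∧ ‖w‖ < R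
    · obtain ⟨l, hl⟩ := hP R hR.1 hR.2
      exact ⟨l, fun _ _ => hl⟩
    · exact ⟨0, fun h1 h2 => absurd ⟨h1, h2⟩ hR⟩
  choose l hl using hl
  have hl0 : Tendsto l atTop (𝓝 0) := by
    refine squeeze_zero_norm' ?_ hlim
    filter_upwards [eventually_ge_atTop 1, eventually_gt_atTop ‖w‖] with R h1 h2
    exact (hl R h1 h2).1
  have hg' : Tendsto (fun R => ∏ i ∈ S R, (1 - w / v i)) atTop (𝓝 (g w)) := by
    have : Tendsto (fun R => g w * exp (-l R)) atTop (𝓝 (g w * exp (-0))) :=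
      (hl0.neg.cexp).const_mul _
    rw [neg_zero, exp_zero, mul_one] at this
    refine this.congr' ?_
    filter_upwards [eventually_ge_atTop 1, eventually_gt_atTop ‖w‖] with R h1 h2
    exact (hl R h1 h2).2
  have htop : Tendsto (fun s : Finset I => ∏ i ∈ s, (1 - w / v i)) atTop
      (𝓝 (∏' i, (1 - w / v i))) := by
    simpa [HasProd] using hmult.hasProd
  -- The product is already known to converge unconditionally, so its value can be read off along
  -- the sets `S R`.
  have := tendsto_nhds_unique hg' (htop.comp hStop)
  rw [this]
  exact hmult.hasProd

end ZeroProducts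

/-! ### Taylor coefficients of the product. -/

section Coefficients

theorem hasFPowerSeriesAt_zero_of_hasSum {g : ℂ → ℂ} {b : ℕ → ℂ}
    (hb : ∀ w, HasSum (fun n => b n * w ^ n) (g w)) :
    HasFPowerSeriesAt g (FormalMultilinearSeries.ofScalars ℂ b) 0 := by
  rw [hasFPowerSeriesAt_iff]
  refine Eventually.of_forall fun w => ?_
  simpa [FormalMultilinearSeries.coeff_ofScalars, mul_comm] using hb w

theorem differentiable_of_hasSum {g : ℂ → ℂ} {b : ℕ → ℂ}
    (hb : ∀ w, HasSum (fun n => b n * w ^ n) (g w)) : Differentiable ℂ g := by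
  have hr : (FormalMultilinearSeries.ofScalars ℂ b : FormalMultilinearSeries ℂ ℂ ℂ).radius = ⊤ := by
    rw [FormalMultilinearSeries.radius_eq_top_iff_summable_norm]
    intro r
    have := (hb (r : ℝ)).summable.norm
    simpa [FormalMultilinearSeries.ofScalars_norm] using this
  have h : HasFPowerSeriesOnBall g (FormalMultilinearSeries.ofScalars ℂ b) 0 ⊤ := by
    refine ⟨hr.ge, by simp, fun {y} _ => ?_⟩
    simpa [FormalMultilinearSeries.ofScalars_apply_eq, mul_comm] using hb y
  intro w
  exact (h.analyticAt_of_mem (by simp)).differentiableAt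

theorem coeff_unique {g : ℂ → ℂ} {b c : ℕ → ℂ}
    (hb : ∀ w, HasSum (fun n => b n * w ^ n) (g w))
    (hc : ∀ w, HasSum (fun n => c n * w ^ n) (g w)) : b = c := by
  have h := (hasFPowerSeriesAt_zero_of_hasSum hb).eq_formalMultilinearSeries
    (hasFPowerSeriesAt_zero_of_hasSum hc)
  ext n
  simpa [FormalMultilinearSeries.coeff_ofScalars] using
    congrArg (fun p : FormalMultilinearSeries ℂ ℂ ℂ => p.coeff n) h

/-- The Taylor coefficients of an absolutely convergent product `∏ (1 - w / v i)` are, up to sign,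
the elementary symmetric functions of the `(v i)⁻¹`. -/
theorem coeff_eq_of_hasProd_one_sub_div {I : Type*} {v : I → ℂ} {g : ℂ → ℂ} {b : ℕ → ℂ}
    (hb : ∀ w, HasSum (fun n => b n * w ^ n) (g w)) (hv : Summable fun i => ‖v i‖⁻¹)
    (hg : ∀ w, HasProd (fun i => 1 - w / v i) (g w)) (n : ℕ) :
    Summable (fun s : {s : Finset I // s.card = n} => (∏ i ∈ s.1, v i)⁻¹) ∧
      b n = (-1) ^ n * ∑' s : {s : Finset I // s.card = n}, (∏ i ∈ s.1, v i)⁻¹ := by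
  have hterm : ∀ (w : ℂ) (s : Finset I),
      ∏ i ∈ s, -(w / v i) = (-w) ^ s.card * (∏ i ∈ s, v i)⁻¹ := by
    intro w s
    rw [← Finset.prod_inv_distrib, ← Finset.prod_const, ← Finset.prod_mul_distrib]
    exact Finset.prod_congr rfl fun i _ => by rw [div_eq_mul_inv, neg_mul]
  have hsum : ∀ w : ℂ, Summable fun s : Finset I => ∏ i ∈ s, -(w / v i) := fun w =>
    summable_finsetProd_of_summable_norm (by simpa [div_eq_mul_inv] using hv.mul_left ‖w‖)
  have hhas : ∀ w : ℂ, HasSum (fun s : Finset I => ∏ i ∈ s, -(w / v i)) (g w) := by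
    intro w
    have h1 := hasProd_one_add_of_hasSum_prod (hsum w).hasSum
    simp only [← sub_eq_add_neg] at h1
    rw [(hg w).unique h1]
    exact (hsum w).hasSum
  have hc : ∀ w, HasSum (fun n => ((-1) ^ n *
      ∑' s : {s : Finset I // s.card = n}, (∏ i ∈ s.1, v i)⁻¹) * w ^ n) (g w) := by
    intro w
    -- Absolute convergence allows grouping the expansion by the size of `s`, which is the power of
    -- `w`.
    refine ((hhas w).tsum_fiberwise Finset.card).congr_fun ?_
    intro m
    have h2 : ∀ s : {s : Finset I // s.card = m},
        ∏ i ∈ s.1, -(w / v i) = (-w) ^ m * (∏ i ∈ s.1, v i)⁻¹ := fun s => by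
      rw [hterm, s.2]
    calc _ = ∑' s : {s : Finset I // s.card = m}, ∏ i ∈ s.1, -(w / v i) := ?_
      _ = _ := rfl
    simp_rw [h2]
    rw [tsum_mul_left, neg_pow]
    ring
  refine ⟨?_, congrFun (coeff_unique hb hc) n⟩
  -- At `w = -1` the terms are exactly the inverse products.
  have h1 := ((hsum (-1)).comp_injective
    (Subtype.val_injective (p := fun s : Finset I => s.card = n)))
  refine h1.congr fun s => ?_
  simp only [Function.comp_apply, hterm, neg_neg, one_pow, one_mul]

end Coefficients

/-! ### Counting leaves over a point of the fibre. -/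

section Leaves

open Complex Metric

/-- Lets a continuous function with values in a finite set be declared constant near `z`. In the
coordinate `(ζ - z) / u` the slit disc is star-shaped about a positive real `ε`. -/
theorem exists_isPreconnected_subset_of_mem_slitNhds {z u : ℂ} (hu : u ≠ 0) {s : Set ℂ}
    (hs : s ∈ slitNhds z u) :
    ∃ t ⊆ s, t ∈ slitNhds z u ∧ IsOpen t ∧ IsPreconnected t ∧ t.Nonempty := by
  obtain ⟨r, hr, hrs⟩ := Metric.mem_nhdsWithin_iff.1 hs
  set ε : ℝ := r / (2 * ‖u‖) with hε
  have hu' : 0 < ‖u‖ := norm_pos_iff.2 hu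
  have hε0 : 0 < ε := by positivity
  have hcont : Continuous fun ζ : ℂ => (ζ - z) / u := by fun_prop
  have hstar : StarConvex ℝ (ε : ℂ) (slitPlane ∩ ball 0 (2 * ε)) :=
    (starConvex_ofReal_slitPlane hε0).inter ((convex_ball _ _).starConvex (by
      rw [mem_ball_zero_iff, norm_real, Real.norm_of_nonneg hε0.le]; linarith))
  have himage : (fun ζ : ℂ => (ζ - z) / u) ⁻¹' (slitPlane ∩ ball 0 (2 * ε)) =
      (fun x : ℂ => z + u * x) '' (slitPlane ∩ ball 0 (2 * ε)) := by
    ext ζ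
    constructor
    · intro h
      exact ⟨_, h, by field_simp; ring⟩
    · rintro ⟨x, hx, rfl⟩
      simpa [hu] using hx
  refine ⟨(fun ζ : ℂ => (ζ - z) / u) ⁻¹' (slitPlane ∩ ball 0 (2 * ε)), ?_, ?_, ?_, ?_, ?_⟩
  · rintro ζ ⟨h1, h2⟩
    refine hrs ⟨?_, h1⟩
    rw [mem_ball_zero_iff, norm_div, div_lt_iff₀ hu', hε] at h2
    rw [mem_ball_iff_norm]
    calc ‖ζ - z‖ < 2 * (r / (2 * ‖u‖)) * ‖u‖ := h2
      _ = r := by field_simp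
  · rw [Set.preimage_inter]
    refine inter_mem_nhdsWithin _ ((isOpen_ball.preimage hcont).mem_nhds ?_)
    simpa using hε0
  · exact (isOpen_slitPlane.inter isOpen_ball).preimage hcont
  · rw [himage]
    exact (hstar.isPathConnected ⟨ofReal_mem_slitPlane.2 hε0, by
      rw [mem_ball_zero_iff, norm_real, Real.norm_of_nonneg hε0.le]; linarith⟩).isConnected.isPreconnected.image
        _ (by fun_prop)
  · rw [himage]
    exact Set.Nonempty.image _ ⟨(ε : ℂ), ofReal_mem_slitPlane.2 hε0, by
      rw [mem_ball_zero_iff, norm_real, Real.norm_of_nonneg hε0.le]; linarith⟩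

theorem slitNhds_neBot {z u : ℂ} (hu : u ≠ 0) : (slitNhds z u).NeBot := by
  refine ⟨fun h => ?_⟩
  obtain ⟨t, ht, -, -, -, hne⟩ := exists_isPreconnected_subset_of_mem_slitNhds hu
    (h ▸ mem_bot : (∅ : Set ℂ) ∈ slitNhds z u)
  exact (hne.mono ht).ne_empty rfl

theorem slitNhds_le_nhds (z u : ℂ) : slitNhds z u ≤ 𝓝 z := nhdsWithin_le_nhds

/-- A zero-free analytic germ has an analytic `m`-th root. -/
theorem exists_analyticAt_pow_eq {H : ℂ → ℂ} {w : ℂ} (hH : AnalyticAt ℂ H w) (hw : H w ≠ 0)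
    {m : ℕ} (hm : m ≠ 0) :
    ∃ q : ℂ → ℂ, AnalyticAt ℂ q w ∧ q w ≠ 0 ∧ ∀ᶠ x in 𝓝 w, q x ^ m = H x := by
  obtain ⟨c, hc⟩ := IsAlgClosed.exists_pow_nat_eq (H w) (Nat.pos_of_ne_zero hm)
  have hc0 : c ≠ 0 := by
    rintro rfl
    exact hw (by rw [← hc, zero_pow hm])
  refine ⟨fun x => c * exp (log (H x / H w) / m), ?_, ?_, ?_⟩
  · have h1 : AnalyticAt ℂ (fun x => H x / H w) w := hH.div analyticAt_const hw
    have h2 : AnalyticAt ℂ (fun x => log (H x / H w)) w := h1.clog (by simp [hw])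
    have hm' : (m : ℂ) ≠ 0 := by exact_mod_cast hm
    exact analyticAt_const.mul ((h2.div analyticAt_const hm').cexp)
  · exact mul_ne_zero hc0 (exp_ne_zero _)
  · filter_upwards [hH.continuousAt.eventually_ne hw] with x hx
    rw [mul_pow, hc, ← exp_nat_mul, mul_div_cancel₀ _ (by exact_mod_cast hm),
      exp_log (div_ne_zero hx hw), mul_div_cancel₀ _ hw]

/-- Near a zero of order `m`, an analytic function is the `m`-th power of a local coordinate. -/
theorem exists_coordinate_pow_eq {F : ℂ → ℂ} {w : ℂ} (hF : AnalyticAt ℂ F w) {m : ℕ}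
    (hm : m ≠ 0) (hord : analyticOrderAt F w = m) :
    ∃ ψ η : ℂ → ℂ, AnalyticAt ℂ ψ w ∧ ψ w = 0 ∧ AnalyticAt ℂ η 0 ∧ η 0 = w ∧
      (∀ᶠ x in 𝓝 w, F x = ψ x ^ m) ∧ (∀ᶠ x in 𝓝 w, η (ψ x) = x) ∧
      ∀ᶠ y in 𝓝 (0 : ℂ), ψ (η y) = y := by
  obtain ⟨h, hh, hh0, hFh⟩ := hF.analyticOrderAt_eq_natCast.1 hord
  obtain ⟨q, hq, hq0, hqm⟩ := exists_analyticAt_pow_eq hh hh0 hm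
  have hψ : AnalyticAt ℂ (fun x => (x - w) * q x) w := by fun_prop
  have hder : deriv (fun x => (x - w) * q x) w ≠ 0 := by
    have : HasDerivAt (fun x => (x - w) * q x) (1 * q w + (w - w) * deriv q w) w :=
      ((hasDerivAt_id w).sub_const w).mul hq.differentiableAt.hasDerivAt
    rw [this.deriv]
    simpa using hq0
  have hψ0 : (w - w) * q w = 0 := by simp
  have hη := hψ.analyticAt_localInverse hder
  refine ⟨fun x => (x - w) * q x, hψ.hasStrictDerivAt.localInverse _ _ _ hder, hψ, hψ0, ?_, ?_, ?_,
    hψ.hasStrictDerivAt.eventually_left_inverse hder, ?_⟩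
  · rwa [hψ0] at hη
  · have := (hψ.hasStrictDerivAt.eventually_left_inverse hder).self_of_nhds
    rwa [hψ0] at this
  · filter_upwards [hFh, hqm] with x h1 h2
    rw [h1, mul_pow, h2, smul_eq_mul]
  · have := hψ.hasStrictDerivAt.eventually_right_inverse hder
    rwa [hψ0] at this

/-- On slit discs about a zero of finite order there are holomorphic roots. -/
theorem exists_root_slitNhds {F : ℂ → ℂ} {z : ℂ} (hF : AnalyticAt ℂ F z)
    (hz : F z = 0) (hord : analyticOrderAt F z ≠ ⊤) {u : ℂ} (hu : u ≠ 0) {m : ℕ} (hm : m ≠ 0) :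
    ∃ θ : ℂ → ℂ, Tendsto θ (slitNhds z u) (𝓝 0) ∧ ∀ᶠ ζ in slitNhds z u,
      DifferentiableAt ℂ θ ζ ∧ θ ζ ≠ 0 ∧ θ ζ ^ m = F ζ := by
  obtain ⟨k, hk⟩ := ENat.ne_top_iff_exists.1 hord
  have hk0 : k ≠ 0 := by
    rintro rfl
    exact hF.analyticOrderAt_ne_zero.2 hz hk.symm
  obtain ⟨h, hh, hh0, hFh⟩ := hF.analyticOrderAt_eq_natCast.1 hk.symm
  obtain ⟨q, hq, hq0, hqm⟩ := exists_analyticAt_pow_eq (H := fun x => u ^ k * h x) (by fun_prop)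
    (mul_ne_zero (pow_ne_zero k hu) hh0) hm
  have hm' : (m : ℂ) ≠ 0 := by exact_mod_cast hm
  have hre : 0 < ((k / m : ℂ)).re := by
    have : ((k / m : ℂ)) = ((k / m : ℝ) : ℂ) := by push_cast; rfl
    rw [this, ofReal_re]
    positivity
  -- The principal power is holomorphic off the slit and tends to `0` since `k / m > 0`. The factor
  -- `u ^ k` put into `q ^ m` undoes the division by `u`.
  refine ⟨fun ζ => ((ζ - z) / u) ^ (k / m : ℂ) * q ζ, ?_, ?_⟩
  · refine Tendsto.mono_left ?_ (slitNhds_le_nhds z u)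
    have h1 : ContinuousAt (fun x : ℂ => x ^ (k / m : ℂ)) ((z - z) / u) :=
      continuousAt_cpow_const_of_re_pos (by simp) hre
    have h2 : ContinuousAt (fun ζ : ℂ => (ζ - z) / u) z := by fun_prop
    have h3 := (ContinuousAt.comp (f := fun ζ : ℂ => (ζ - z) / u) h1 h2).mul hq.continuousAt
    have h4 := h3.tendsto
    simp only [Function.comp_apply, Pi.mul_apply, sub_self, zero_div] at h4
    rw [zero_cpow (fun h0 => by simp [h0] at hre), zero_mul] at h4
    exact h4
  · have hslit : ∀ᶠ ζ in slitNhds z u, (ζ - z) / u ∈ slitPlane := self_mem_nhdsWithin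
    filter_upwards [hslit, slitNhds_le_nhds z u hq.eventually_analyticAt,
      slitNhds_le_nhds z u (hq.continuousAt.eventually_ne hq0), slitNhds_le_nhds z u hqm,
      slitNhds_le_nhds z u hFh] with ζ h1 h2 h3 h4 h5
    have h0 := slitPlane_ne_zero h1
    refine ⟨?_, mul_ne_zero (by simp [cpow_eq_zero_iff, h0]) h3, ?_⟩
    · have hd : DifferentiableAt ℂ (fun ζ : ℂ => (ζ - z) / u) ζ := by fun_prop
      exact (hd.cpow_const h1).mul h2.differentiableAt
    · rw [mul_pow, h4, h5, ← cpow_nat_mul, mul_div_cancel₀ _ hm', cpow_natCast, div_pow,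
        smul_eq_mul]
      field_simp

theorem AutomorphicBranch.apply_value {f : ℂ → ℂ} {z u : ℂ} (hf : Continuous f) (hu : u ≠ 0)
    (b : AutomorphicBranch f z u) : f b.value = f z := by
  have := slitNhds_neBot (z := z) hu
  obtain ⟨φ, -, hφ⟩ := b.isBranch
  refine tendsto_nhds_unique ((hf.tendsto _).comp hφ.tendsto) ?_
  refine Tendsto.congr' ?_ ((hf.tendsto z).mono_left (slitNhds_le_nhds z u))
  filter_upwards [hφ.automorphic] with ζ h using h.symm

/-- The leaves with value `w` are parametrised by the `m`-th roots of unity `ω`, through `φ = η (ω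
θ)` with `η` the local inverse of `ψ`. -/
theorem AutomorphicBranch.encard_value_eq_of_order {f : ℂ → ℂ} {z u w : ℂ}
    (hf : Differentiable ℂ f) (hu : u ≠ 0) (hzord : analyticOrderAt (fun x => f x - f z) z ≠ ⊤)
    {m : ℕ} (hm : m ≠ 0) (hord : analyticOrderAt (fun x => f x - f z) w = m) :
    {b : AutomorphicBranch f z u | b.value = w}.encard = m := by
  have hne := slitNhds_neBot (z := z) hu
  have : NeZero m := ⟨hm⟩
  have hF : Differentiable ℂ fun x => f x - f z := by fun_prop
  obtain ⟨ψ, η, hψ, hψ0, hη, hη0, hFψ, hηψ, hψη⟩ :=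
    exists_coordinate_pow_eq (hF.analyticAt w) hm hord
  obtain ⟨θ, hθ0, hθ⟩ := exists_root_slitNhds (hF.analyticAt z) (by simp) hzord hu hm
  have hωθ : ∀ c : ℂ, Tendsto (fun ζ => c * θ ζ) (slitNhds z u) (𝓝 0) := fun c => by
    simpa using hθ0.const_mul c
  have hlim : ∀ c : ℂ, Tendsto (fun ζ => η (c * θ ζ)) (slitNhds z u) (𝓝 w) := fun c => by
    have := hη.continuousAt.tendsto.comp (hωθ c)
    rwa [hη0] at this
  have hbranch : ∀ ω : rootsOfUnity m ℂ,
      IsAutomorphicBranch f z u (fun ζ => η ((ω : ℂˣ) * θ ζ)) w := by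
    intro ω
    refine ⟨?_, ?_, hlim _⟩
    · filter_upwards [(hωθ (ω : ℂˣ)).eventually hη.eventually_analyticAt, hθ] with ζ h1 h2
      exact DifferentiableAt.comp ζ (g := η) h1.differentiableAt (h2.1.const_mul _)
    · filter_upwards [(hlim (ω : ℂˣ)).eventually hFψ, (hωθ (ω : ℂˣ)).eventually hψη, hθ]
        with ζ h1 h2 h3
      have hω : ((ω : ℂˣ) : ℂ) ^ m = 1 := by
        rw [← Units.val_pow_eq_pow_val, (_root_.mem_rootsOfUnity m _).1 ω.2, Units.val_one]
      rw [h2, mul_pow, hω, one_mul, h3.2.2] at h1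
      exact sub_left_injective h1
  let T : rootsOfUnity m ℂ → AutomorphicBranch f z u := fun ω =>
    ⟨((fun ζ => η ((ω : ℂˣ) * θ ζ) : ℂ → ℂ) : (slitNhds z u).Germ ℂ), w, _, rfl, hbranch ω⟩
  have hinj : Function.Injective T := by
    intro ω ω' h
    have h1 : (fun ζ => η ((ω : ℂˣ) * θ ζ)) =ᶠ[slitNhds z u] fun ζ => η ((ω' : ℂˣ) * θ ζ) :=
      Germ.coe_eq.1 (congrArg AutomorphicBranch.germ h)
    obtain ⟨ζ, h2, h3, h4, h5⟩ := (h1.and (((hωθ (ω : ℂˣ)).eventually hψη).and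
      (((hωθ (ω' : ℂˣ)).eventually hψη).and hθ))).exists
    have h6 := congrArg ψ h2
    simp only at h6
    rw [h3, h4] at h6
    exact Subtype.ext (Units.ext (mul_right_cancel₀ h5.2.1 h6))
  have hrange : {b : AutomorphicBranch f z u | b.value = w} = Set.range T := by
    ext b
    constructor
    · intro (hb : b.value = w)
      obtain ⟨φ, hφb, hφ⟩ := b.isBranch
      have hlimφ := hφ.tendsto
      rw [hb] at hlimφ
      -- For any leaf, `ψ ∘ φ / θ` is a continuous `m`-th root of unity, hence constant on a
      -- connected slit disc. This constant is the required `ω`.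
      have hev : ∀ᶠ ζ in slitNhds z u, ContinuousAt (fun x => ψ (φ x) / θ x) ζ ∧
          (ψ (φ ζ) / θ ζ) ^ m = 1 ∧ η (ψ (φ ζ)) = φ ζ ∧ θ ζ ≠ 0 := by
        filter_upwards [hφ.differentiableAt, hφ.automorphic, hlimφ.eventually hFψ,
          hlimφ.eventually hηψ, hlimφ.eventually hψ.eventually_analyticAt, hθ]
          with ζ h1 h2 h3 h4 h5 h6
        refine ⟨?_, ?_, h4, h6.2.1⟩
        · exact (ContinuousAt.comp (g := ψ) h5.continuousAt h1.continuousAt).div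
            h6.1.continuousAt h6.2.1
        · rw [div_pow, h6.2.2, ← h3, h2, div_self]
          rw [← h6.2.2]
          exact pow_ne_zero _ h6.2.1
      obtain ⟨t, hts, ht, -, htc, htn⟩ := exists_isPreconnected_subset_of_mem_slitNhds hu hev
      obtain ⟨ζ₀, hζ₀⟩ := htn
      have hfin : {x : ℂ | x ^ m = 1}.Finite := by
        have : {x : ℂ | x ^ m = 1} = (Polynomial.nthRootsFinset m (1 : ℂ) : Set ℂ) := by
          ext x
          simp [Polynomial.mem_nthRootsFinset (Nat.pos_of_ne_zero hm)]
        rw [this]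
        exact Finset.finite_toSet _
      have hconst : ∀ ζ ∈ t, ψ (φ ζ) / θ ζ = ψ (φ ζ₀) / θ ζ₀ := fun ζ hζ =>
        htc.constant_of_mapsTo hfin.isDiscrete
          (fun x hx => (hts hx).1.continuousWithinAt) (fun x hx => (hts hx).2.1) hζ hζ₀
      refine ⟨rootsOfUnity.mkOfPowEq _ (hts hζ₀).2.1, ?_⟩
      refine AutomorphicBranch.ext ?_ hb.symm
      rw [← hφb]
      refine Germ.coe_eq.2 ?_
      filter_upwards [ht] with ζ hζ
      rw [rootsOfUnity.val_mkOfPowEq_coe, ← hconst ζ hζ, div_mul_cancel₀ _ (hts hζ).2.2.2,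
        (hts hζ).2.2.1]
    · rintro ⟨ω, rfl⟩
      rfl
  rw [hrange, ← Set.image_univ, hinj.encard_image, Set.encard_univ, ENat.card_eq_coe_natCard,
    Complex.card_rootsOfUnity]

/-- The number of leaves with value `w` at `z` is the order of `f - f z` at `w`. -/
theorem AutomorphicBranch.encard_value_eq {f : ℂ → ℂ} {z u : ℂ}
    (hf : Differentiable ℂ f) (hu : u ≠ 0) {x₀ : ℂ} (hx₀ : f x₀ ≠ f z) (w : ℂ) :
    {b : AutomorphicBranch f z u | b.value = w}.encard =
      analyticOrderAt (fun x => f x - f z) w := by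
  have hF : Differentiable ℂ fun x => f x - f z := by fun_prop
  -- Infinite order anywhere would make `f` constant by the identity theorem, contradicting `f x₀ ≠
  -- f z`.
  have htop : ∀ x, analyticOrderAt (fun x => f x - f z) x ≠ ⊤ := by
    intro x hx
    rw [AnalyticOnNhd.analyticOrderAt_eq_top_iff_eq_zero x (fun y => hF.analyticAt y)] at hx
    exact hx₀ (sub_eq_zero.1 (congrFun hx x₀))
  obtain ⟨m, hm⟩ := ENat.ne_top_iff_exists.1 (htop w)
  by_cases hm0 : m = 0
  · have h1 : analyticOrderAt (fun x => f x - f z) w = 0 := by rw [← hm, hm0]; rfl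
    have h2 := (hF.analyticAt w).analyticOrderAt_eq_zero.1 h1
    rw [h1, Set.encard_eq_zero, Set.eq_empty_iff_forall_notMem]
    rintro b rfl
    exact h2 (sub_eq_zero.2 (b.apply_value hf.continuous hu))
  · rw [← hm]
    exact encard_value_eq_of_order hf hu (htop z) hm0 hm.symm

end Leaves

/-! ### Growth bound and conclusion. -/

/-- An entire function of order less than one satisfies a global growth bound with an exponent
less than one. -/
theorem exists_growth_bound {f : ℂ → ℂ} (hf : Continuous f) (hord : entireOrder f < 1) :
    ∃ C α : ℝ, 0 ≤ C ∧ 0 ≤ α ∧ α < 1 ∧ ∀ w, ‖f w‖ ≤ C * Real.exp (‖w‖ ^ α) := by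
  simp only [entireOrder, iInf_lt_iff] at hord
  obtain ⟨α, hα, hα1⟩ := hord
  rw [Filter.hasBasis_cocompact.eventually_iff] at hα
  obtain ⟨K, hK, hKf⟩ := hα
  obtain ⟨C, hC⟩ := hK.exists_bound_of_continuousOn hf.continuousOn
  refine ⟨max C 1, α, by positivity, α.2, by exact_mod_cast hα1, fun w => ?_⟩
  by_cases hw : w ∈ K
  · calc ‖f w‖ ≤ max C 1 := (hC w hw).trans (le_max_left _ _)
      _ ≤ max C 1 * Real.exp (‖w‖ ^ (α : ℝ)) :=
        le_mul_of_one_le_right (by positivity) (Real.one_le_exp (by positivity))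
  · exact (hKf hw).trans (le_mul_of_one_le_left (Real.exp_pos _).le (le_max_right _ _))

theorem theorem17 (f : ℂ → ℂ) (a : ℕ → ℂ)
    (hf : ∀ w : ℂ, HasSum (fun n : ℕ => a n * w ^ n) (f w))
    (ρ : ℝ≥0) (hρ : entireOrder f = (ρ : ℝ≥0∞)) (hρ1 : ρ < 1)
    (z : ℂ) (hz : z ∉ f ⁻¹' {f 0})
    (u : ℂ) (hu : u ≠ 0) (n : ℕ) (hn : 1 ≤ n) :
    Summable (fun s : {s : Finset (AutomorphicBranch f z u) // s.card = n} =>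
        (∏ φ ∈ s.1, φ.value)⁻¹) ∧
      a n = (-1) ^ n * (f 0 - f z) *
        ∑' s : {s : Finset (AutomorphicBranch f z u) // s.card = n}, (∏ φ ∈ s.1, φ.value)⁻¹ := by
  have hfd : Differentiable ℂ f := differentiable_of_hasSum hf
  have hz0 : f 0 ≠ f z := fun h => hz h.symm
  have hd : f 0 - f z ≠ 0 := sub_ne_zero.2 hz0
  obtain ⟨C, α, hC, hα, hα1, hgrowth⟩ := exists_growth_bound hfd.continuous
    (by rw [hρ]; exact_mod_cast hρ1)
  set g : ℂ → ℂ := fun w => (f 0 - f z)⁻¹ * (f w - f z) with hg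
  have hgd : Differentiable ℂ g := by fun_prop
  have hg0 : g 0 = 1 := inv_mul_cancel₀ hd
  have hv : ∀ b : AutomorphicBranch f z u, b.value ≠ 0 := fun b hb =>
    hz0 (hb ▸ b.apply_value hfd.continuous hu)
  have hord : ∀ w, {b : AutomorphicBranch f z u | b.value = w}.encard = analyticOrderAt g w := by
    intro w
    have h1 : g = (fun _ => (f 0 - f z)⁻¹) * fun w => f w - f z := rfl
    have h2 : analyticOrderAt (fun _ : ℂ => (f 0 - f z)⁻¹) w = 0 :=
      analyticOrderAt_eq_zero.2 (Or.inr (inv_ne_zero hd))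
    rw [AutomorphicBranch.encard_value_eq hfd hu hz0, h1, analyticOrderAt_mul (by fun_prop)
      (Differentiable.analyticAt (by fun_prop) w), h2, zero_add]
  have hgg : ∀ w, ‖g w‖ ≤ max 1 (‖(f 0 - f z)⁻¹‖ * (C + ‖f z‖)) * Real.exp (‖w‖ ^ α) := by
    intro w
    have hexp : 1 ≤ Real.exp (‖w‖ ^ α) := Real.one_le_exp (by positivity)
    calc ‖g w‖ = ‖(f 0 - f z)⁻¹‖ * ‖f w - f z‖ := norm_mul _ _
      _ ≤ ‖(f 0 - f z)⁻¹‖ * (C * Real.exp (‖w‖ ^ α) + ‖f z‖ * Real.exp (‖w‖ ^ α)) := by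
        gcongr
        refine (norm_sub_le _ _).trans ?_
        gcongr
        · exact hgrowth w
        · exact le_mul_of_one_le_right (norm_nonneg _) hexp
      _ = ‖(f 0 - f z)⁻¹‖ * (C + ‖f z‖) * Real.exp (‖w‖ ^ α) := by ring
      _ ≤ _ := by gcongr; exact le_max_right _ _
  obtain ⟨hsum, hprod⟩ := hasProd_one_sub_div hgd hg0 hv hord (le_max_left _ _) hα hα1 hgg
  -- Subtracting `f z` changes only the constant coefficient, so for `n ≥ 1` the coefficient of `g`
  -- is `a n / (f 0 - f z)`.
  have hser : ∀ w, HasSum (fun n => ((f 0 - f z)⁻¹ * (a n - if n = 0 then f z else 0)) * w ^ n)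
      (g w) := by
    intro w
    refine (((hf w).sub (hasSum_ite_eq 0 (f z))).mul_left (f 0 - f z)⁻¹).congr_fun fun n => ?_
    split_ifs with h
    · simp [h]
    · ring
  obtain ⟨h1, h2⟩ := coeff_eq_of_hasProd_one_sub_div hser hsum hprod n
  refine ⟨h1, ?_⟩
  rw [if_neg (by lia), sub_zero, inv_mul_eq_iff_eq_mul₀ hd] at h2
  rw [h2]
  ring
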